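/- Let $F$ be a field of characteristic different from $2$ and let $A$ be a Novikov algebra over $F$, that is, a (not necessarily associative or unital) $F$-algebra satisfying $(x,y,z)=(y,x,z)$ and $(xy)z=(xz)y$ for all $x,y,z\in A$, where $(x,y,z)=(xy)z-x(yz)$. Put $A^{(0)_L}=A$ and let $A^{(n+1)_L}$ be the subspace spanned by all commutators $xy-yx$ with $x,y\in A^{(n)_L}$; assume that $A$ is Lie-solvable, i.e. $A^{(n)_L}=0$ for some $n\ge 0$. An algebra $R$ is called left-quasiregular if for every $x\in R$ there is $y\in R$ with $x+y=yx$. Let $J(A)$, the left-quasiregular radical of $A$, be the sum of all two-sided ideals of $A$ that are left-quasiregular as algebras. Then $J(A)$ is itself left-quasiregular (so it is the largest left-quasiregular ideal of $A$), and $$J(A)=\bigcap\{\,I : I \text{ is a two-sided ideal of } A \text{ such that } A/I \text{ is a field}\,\},$$ where the intersection of the empty family is $A$. Here "$A/I$ is a field" means that $A/I$ is commutative and associative, has an identity element $e\neq 0$, and each of its nonzero elements is invertible. -/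

import Mathlib

/-- A Novikov ring: the associator `(x, y, z) = (x * y) * z - x * (y * z)` is symmetric in
its first two arguments (this is `LeftPreLieRing`), and right multiplications commute. A Novikov
algebra over a field `F` is a Novikov ring with a compatible `F`-module structure. -/
class NovikovRing (A : Type*) extends LeftPreLieRing A where
  /-- The identity `(x y) z = (x z) y`. -/
  right_comm : ∀ x y z : A, (x * y) * z = (x * z) * y

/-- The Lie-solvable powers: the whole algebra in degree `0`, and in degree `n + 1` the subspace
spanned by all commutators of elements of the `n`-th power. -/
def lieSolvablePower (F A : Type*) [Field F] [NonUnitalNonAssocRing A] [Module F A] :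
    ℕ → Submodule F A
  | 0 => ⊤
  | n + 1 => Submodule.span F {z : A | ∃ x ∈ lieSolvablePower F A n,
      ∃ y ∈ lieSolvablePower F A n, z = x * y - y * x}

/-- An algebra is Lie-solvable if one of its Lie-solvable powers is zero. -/
def IsLieSolvableAlgebra (F A : Type*) [Field F] [NonUnitalNonAssocRing A] [Module F A] : Prop :=
  ∃ n : ℕ, lieSolvablePower F A n = ⊥

/-- An ideal of a (not necessarily associative or unital) `F`-algebra: a subspace that is stable
under left and right multiplication by arbitrary elements. -/
structure AlgIdeal (F A : Type*) [Field F] [NonUnitalNonAssocRing A] [Module F A] extends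
    Submodule F A where
  left_mul_mem : ∀ (a : A) {x : A}, x ∈ toSubmodule → a * x ∈ toSubmodule
  right_mul_mem : ∀ (a : A) {x : A}, x ∈ toSubmodule → x * a ∈ toSubmodule

/-- An element `x` is left-quasiregular if `x + y = y x` for some `y`. -/
def IsLeftQuasiregularElt {R : Type*} [NonUnitalNonAssocRing R] (x : R) : Prop :=
  ∃ y : R, x + y = y * x

/-- An algebra is left-quasiregular if all its elements are. -/
def IsLeftQuasiregularAlgebra (R : Type*) [NonUnitalNonAssocRing R] : Prop :=
  ∀ x : R, IsLeftQuasiregularElt x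

/-- `R` is a field: commutative, associative, with an identity element `e ≠ 0`, and every nonzero
element is invertible. -/
def IsFieldAlgebra (R : Type*) [NonUnitalNonAssocRing R] : Prop :=
  (∀ x y : R, x * y = y * x) ∧ (∀ x y z : R, (x * y) * z = x * (y * z)) ∧
    ∃ e : R, e ≠ 0 ∧ (∀ x : R, e * x = x) ∧ ∀ x : R, x ≠ 0 → ∃ y : R, x * y = e

namespace AlgIdeal

variable {F A : Type*} [Field F] [NonUnitalNonAssocRing A] [Module F A]

/-- An ideal regarded as a subalgebra, hence as an algebra in its own right. -/
def toSubalgebra (I : AlgIdeal F A) : NonUnitalSubalgebra F A where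
  toNonUnitalSubsemiring :=
    { carrier := {x : A | x ∈ I.toSubmodule}
      add_mem' := fun hx hy => I.toSubmodule.add_mem hx hy
      zero_mem' := I.toSubmodule.zero_mem
      mul_mem' := fun {x _} _ hy => I.left_mul_mem x hy }
  smul_mem' := fun c _ hx => I.toSubmodule.smul_mem c hx

/-- The underlying space of the quotient algebra `A / I`. -/
def Quot (I : AlgIdeal F A) : Type _ := A ⧸ I.toSubmodule

instance (I : AlgIdeal F A) : AddCommGroup I.Quot :=
  inferInstanceAs (AddCommGroup (A ⧸ I.toSubmodule))

instance (I : AlgIdeal F A) : Module F I.Quot :=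
  inferInstanceAs (Module F (A ⧸ I.toSubmodule))

/-- The class of `a` in the quotient algebra. -/
def toQuot (I : AlgIdeal F A) (a : A) : I.Quot := Submodule.Quotient.mk (p := I.toSubmodule) a

/-- The multiplication of the quotient algebra, `(a + I) (b + I) = a b + I`. -/
instance (I : AlgIdeal F A) : Mul I.Quot where
  mul := Quotient.map₂ (fun a b : A => a * b) (by
    intro a a' ha b b' hb
    have ha' : a - a' ∈ I.toSubmodule := (Submodule.quotientRel_def _).1 ha
    have hb' : b - b' ∈ I.toSubmodule := (Submodule.quotientRel_def _).1 hb
    refine (Submodule.quotientRel_def _).2 ?_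
    have h : a * b - a' * b' = a * (b - b') + (a - a') * b' := by
      rw [mul_sub, sub_mul]; abel
    rw [h]
    exact I.toSubmodule.add_mem (I.left_mul_mem a hb') (I.right_mul_mem b' ha'))

theorem toQuot_mul (I : AlgIdeal F A) (a b : A) : I.toQuot (a * b) = I.toQuot a * I.toQuot b := rfl

theorem toQuot_add (I : AlgIdeal F A) (a b : A) : I.toQuot (a + b) = I.toQuot a + I.toQuot b := rfl

theorem toQuot_surjective (I : AlgIdeal F A) : Function.Surjective I.toQuot :=
  Submodule.Quotient.mk_surjective _

instance (I : AlgIdeal F A) : NonUnitalNonAssocRing I.Quot where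
  left_distrib x y z := by
    obtain ⟨a, rfl⟩ := I.toQuot_surjective x
    obtain ⟨b, rfl⟩ := I.toQuot_surjective y
    obtain ⟨c, rfl⟩ := I.toQuot_surjective z
    simp only [← toQuot_mul, ← toQuot_add, mul_add]
  right_distrib x y z := by
    obtain ⟨a, rfl⟩ := I.toQuot_surjective x
    obtain ⟨b, rfl⟩ := I.toQuot_surjective y
    obtain ⟨c, rfl⟩ := I.toQuot_surjective z
    simp only [← toQuot_mul, ← toQuot_add, add_mul]
  zero_mul x := by
    obtain ⟨a, rfl⟩ := I.toQuot_surjective x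
    change I.toQuot 0 * I.toQuot a = I.toQuot 0
    rw [← toQuot_mul, zero_mul]
  mul_zero x := by
    obtain ⟨a, rfl⟩ := I.toQuot_surjective x
    change I.toQuot a * I.toQuot 0 = I.toQuot 0
    rw [← toQuot_mul, mul_zero]

end AlgIdeal

/-- The left-quasiregular radical: the sum of all left-quasiregular ideals. -/
def leftQuasiregularRadical (F A : Type*) [Field F] [NonUnitalNonAssocRing A] [Module F A] :
    AlgIdeal F A where
  toSubmodule := sSup {S : Submodule F A | ∃ I : AlgIdeal F A,
    IsLeftQuasiregularAlgebra I.toSubalgebra ∧ S = I.toSubmodule}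
  left_mul_mem a x hx := by
    rw [sSup_eq_iSup'] at hx ⊢
    induction hx using Submodule.iSup_induction' with
    | mem i x hi =>
      obtain ⟨I, _, h⟩ := i.2
      refine Submodule.mem_iSup_of_mem i ?_
      rw [h] at hi ⊢
      exact I.left_mul_mem a hi
    | zero => rw [mul_zero]; exact Submodule.zero_mem _
    | add x y _ _ hx hy => rw [mul_add]; exact Submodule.add_mem _ hx hy
  right_mul_mem a x hx := by
    rw [sSup_eq_iSup'] at hx ⊢
    induction hx using Submodule.iSup_induction' with
    | mem i x hi =>
      obtain ⟨I, _, h⟩ := i.2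
      refine Submodule.mem_iSup_of_mem i ?_
      rw [h] at hi ⊢
      exact I.right_mul_mem a hi
    | zero => rw [zero_mul]; exact Submodule.zero_mem _
    | add x y _ _ hx hy => rw [add_mul]; exact Submodule.add_mem _ hx hy

/-!
Write `A (1 - x)` for the image of `a ↦ a - a x`. It is a right ideal, and `x` is left-quasiregular
modulo an ideal `L` exactly if `x ∈ A (1 - x) + L`. The quotient `A / [A, A]` is commutative and
associative, so there an element that is not quasiregular is sent to `1` by some homomorphism onto
a field, namely the residue field of a maximal ideal of the unitization containing `1 - x`. Hence
every `x` that lies in all ideals with field quotient satisfies `A (1 - x) + [A, A] = A`.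

Solvability enters by lifting this along the derived series. Suppose `A (1 - x) + L = A` for an
ideal `L ⊆ [A, A]`. The identities of a Novikov algebra give `A (1 - x) + ((L L) L) L = A`. Moreover
`L L ⊆ [A, L]`, and `D = [a, ·]` satisfies `D (c d) ≡ 2 (D c) d` modulo `[L, L]`, which by
associativity modulo `[L, L]` forces `((D c) d) e ∈ [L, L]`, so that `((L L) L) L ⊆ [L, L]`. In
characteristic other than `2` the subspace `[L, L]` is an ideal, and the step can be repeated.
-/

theorem mem_of_two_nsmul_mem {F V : Type*} [DivisionRing F] [NeZero (2 : F)] [AddCommGroup V]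
    [Module F V] {S : Submodule F V} {v : V} (h : 2 • v ∈ S) : v ∈ S := by
  rwa [← ofNat_smul_eq_nsmul F 2 v, S.smul_mem_iff (NeZero.ne (2 : F))] at h

theorem lie_mul_eq_mul_mul_sub {A : Type*} [LeftPreLieRing A] (a b c : A) :
    ⁅a, b⁆ * c = a * (b * c) - b * (a * c) := by
  rw [Ring.lie_def, sub_mul]
  exact sub_eq_sub_iff_sub_eq_sub.2 (LeftPreLieRing.assoc_symm a b c)

namespace NovikovRing

variable {A : Type*} [NovikovRing A] (a b c : A)

theorem two_nsmul_lie_mul : 2 • (⁅a, b⁆ * c) = ⁅a * c, b⁆ + ⁅a, b * c⁆ := by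
  rw [two_nsmul]
  nth_rw 1 [lie_mul_eq_mul_mul_sub]
  simp only [Ring.lie_def, sub_mul, right_comm a c b, right_comm b c a]
  abel

theorem associator_eq_lie_mul_add_lie : associator a b c = ⁅a, b⁆ * c + ⁅b * c, a⁆ := by
  simp only [associator_apply, Ring.lie_def, sub_mul, right_comm b c a]
  abel

end NovikovRing

section CommutatorSpan

variable {F A : Type*} [Ring F] [NonUnitalNonAssocRing A] [Module F A] {S T : Submodule F A}

/-- The subspace `[S, T]` spanned by the commutators of elements of `S` with elements of `T`. -/
def commutatorSpan (S T : Submodule F A) : Submodule F A :=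
  Submodule.span F {z : A | ∃ x ∈ S, ∃ y ∈ T, z = x * y - y * x}

theorem lie_mem_commutatorSpan {s t : A} (hs : s ∈ S) (ht : t ∈ T) : ⁅s, t⁆ ∈ commutatorSpan S T :=
  Submodule.subset_span ⟨s, hs, t, ht, rfl⟩

theorem map_mem_of_mem_commutatorSpan {V : Type*} [AddCommGroup V] [Module F V] {U : Submodule F V}
    (f : A →ₗ[F] V) (h : ∀ s ∈ S, ∀ t ∈ T, f ⁅s, t⁆ ∈ U) {x : A} (hx : x ∈ commutatorSpan S T) :
    f x ∈ U := by
  suffices hle : commutatorSpan S T ≤ U.comap f from hle hx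
  refine Submodule.span_le.2 ?_
  rintro _ ⟨s, hs, t, ht, rfl⟩
  exact h s hs t ht

theorem commutatorSpan_mono {S' T' : Submodule F A} (hS : S ≤ S') (hT : T ≤ T') :
    commutatorSpan S T ≤ commutatorSpan S' T' := fun _ hx =>
  map_mem_of_mem_commutatorSpan LinearMap.id
    (fun _ hs _ ht => lie_mem_commutatorSpan (hS hs) (hT ht)) hx

theorem commutatorSpan_bot_left (T : Submodule F A) : commutatorSpan ⊥ T = ⊥ := by
  refine eq_bot_iff.2 fun x hx => map_mem_of_mem_commutatorSpan LinearMap.id ?_ hx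
  rintro s hs t -
  simp [(Submodule.mem_bot F).1 hs, Ring.lie_def]

end CommutatorSpan

theorem mul_mem_of_mem_commutatorSpan {F A : Type*} [DivisionRing F] [NeZero (2 : F)]
    [NovikovRing A] [Module F A] [IsScalarTower F A A] {S T U : Submodule F A} {u : A}
    (h : ∀ s ∈ S, ∀ t ∈ T, ⁅s * u, t⁆ + ⁅s, t * u⁆ ∈ U) {x : A} (hx : x ∈ commutatorSpan S T) :
    x * u ∈ U := by
  refine map_mem_of_mem_commutatorSpan (LinearMap.mulRight F u) (fun s hs t ht => ?_) hx
  refine mem_of_two_nsmul_mem (F := F) ?_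
  rw [LinearMap.mulRight_apply, NovikovRing.two_nsmul_lie_mul]
  exact h s hs t ht

theorem lie_mem_of_mem_commutatorSpan {F A : Type*} [Ring F] [LieAdmissibleRing A] [Module F A]
    [IsScalarTower F A A] [SMulCommClass F A A] {S T U : Submodule F A} {a : A}
    (h : ∀ s ∈ S, ∀ t ∈ T, ⁅⁅a, s⁆, t⁆ + ⁅s, ⁅a, t⁆⁆ ∈ U) {x : A} (hx : x ∈ commutatorSpan S T) :
    ⁅a, x⁆ ∈ U := by
  refine map_mem_of_mem_commutatorSpan (LinearMap.mulLeft F a - LinearMap.mulRight F a)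
    (fun s hs t ht => ?_) hx
  change ⁅a, ⁅s, t⁆⁆ ∈ U
  rw [leibniz_lie]
  exact h s hs t ht

namespace AlgIdeal

section NonAssoc

variable {F A : Type*} [Field F] [NonUnitalNonAssocRing A] [Module F A]

instance : Top (AlgIdeal F A) where
  top := ⟨⊤, fun _ _ _ => Submodule.mem_top, fun _ _ _ => Submodule.mem_top⟩

theorem lie_mem (L : AlgIdeal F A) (a : A) {x : A} (hx : x ∈ L.toSubmodule) :
    ⁅a, x⁆ ∈ L.toSubmodule :=
  sub_mem (L.left_mul_mem a hx) (L.right_mul_mem a hx)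

end NonAssoc

theorem lie_mem_commutatorSpan_self {F A : Type*} [Field F] [LieAdmissibleRing A] [Module F A]
    [IsScalarTower F A A] [SMulCommClass F A A] (L : AlgIdeal F A) (a : A) {x : A}
    (hx : x ∈ commutatorSpan L.toSubmodule L.toSubmodule) :
    ⁅a, x⁆ ∈ commutatorSpan L.toSubmodule L.toSubmodule :=
  lie_mem_of_mem_commutatorSpan (fun _ hs _ ht =>
    add_mem (lie_mem_commutatorSpan (L.lie_mem a hs) ht)
      (lie_mem_commutatorSpan hs (L.lie_mem a ht))) hx

variable {F A : Type*} [Field F] [NeZero (2 : F)] [NovikovRing A] [Module F A]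
  [IsScalarTower F A A]

theorem mul_mem_commutatorSpan_top (L : AlgIdeal F A) {c l : A}
    (hc : c ∈ commutatorSpan (⊤ : Submodule F A) ⊤) (hl : l ∈ L.toSubmodule) :
    c * l ∈ commutatorSpan ⊤ L.toSubmodule := by
  refine mul_mem_of_mem_commutatorSpan (fun a _ b _ => ?_) hc
  rw [← lie_skew (a * l) b]
  exact add_mem (neg_mem (lie_mem_commutatorSpan Submodule.mem_top (L.left_mul_mem a hl)))
    (lie_mem_commutatorSpan Submodule.mem_top (L.left_mul_mem b hl))

theorem mul_mem_commutatorSpan_self (L : AlgIdeal F A) (a : A) {x : A}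
    (hx : x ∈ commutatorSpan L.toSubmodule L.toSubmodule) :
    x * a ∈ commutatorSpan L.toSubmodule L.toSubmodule :=
  mul_mem_of_mem_commutatorSpan (fun _ hs _ ht =>
    add_mem (lie_mem_commutatorSpan (L.right_mul_mem a hs) ht)
      (lie_mem_commutatorSpan hs (L.right_mul_mem a ht))) hx

variable [SMulCommClass F A A]

/-- The ideal `[L, L]` of a Novikov algebra. -/
def derived (L : AlgIdeal F A) : AlgIdeal F A where
  toSubmodule := commutatorSpan L.toSubmodule L.toSubmodule
  right_mul_mem a _ hx := L.mul_mem_commutatorSpan_self a hx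
  left_mul_mem a x hx := by
    rw [← sub_add_cancel (a * x) (x * a)]
    exact add_mem (L.lie_mem_commutatorSpan_self a hx) (L.mul_mem_commutatorSpan_self a hx)

theorem associator_mem_derived (L : AlgIdeal F A) {p q : A} (r : A) (hp : p ∈ L.toSubmodule)
    (hq : q ∈ L.toSubmodule) : associator p q r ∈ L.derived.toSubmodule := by
  rw [NovikovRing.associator_eq_lie_mul_add_lie]
  exact add_mem (L.derived.right_mul_mem r (lie_mem_commutatorSpan hp hq))
    (lie_mem_commutatorSpan (L.right_mul_mem r hq) hp)

theorem lie_mul_smodEq (L : AlgIdeal F A) (a : A) {c d : A} (hc : c ∈ L.toSubmodule)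
    (hd : d ∈ L.toSubmodule) : ⁅a, c * d⁆ ≡ 2 • (⁅a, c⁆ * d) [SMOD L.derived.toSubmodule] := by
  rw [NovikovRing.two_nsmul_lie_mul, ← sub_smodEq_zero, SModEq.zero, sub_add_cancel_right,
    lie_skew]
  exact lie_mem_commutatorSpan hc (L.left_mul_mem a hd)

/-- Modulo `[L, L]` the map `D = [a, ·]` satisfies `D (c d) = 2 (D c) d`; evaluating
`D (c d e)` along both bracketings gives `4 (D c) d e = 2 (D c) d e`. -/
theorem lie_mul_mul_mem_derived (L : AlgIdeal F A) (a : A) {c d e : A} (hc : c ∈ L.toSubmodule)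
    (hd : d ∈ L.toSubmodule) (he : e ∈ L.toSubmodule) :
    (⁅a, c⁆ * d) * e ∈ L.derived.toSubmodule := by
  have h_assoc {p : A} (hp : p ∈ L.toSubmodule) :
      (p * d) * e ≡ p * (d * e) [SMOD L.derived.toSubmodule] :=
    SModEq.sub_mem.2 (L.associator_mem_derived e hp hd)
  have h_lie_assoc : ⁅a, (c * d) * e⁆ ≡ ⁅a, c * (d * e)⁆ [SMOD L.derived.toSubmodule] := by
    rw [SModEq.sub_mem, ← lie_sub]
    exact L.derived.lie_mem a (L.associator_mem_derived e hc hd)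
  have h_mul_right : ⁅a, c * d⁆ * e ≡ (2 • (⁅a, c⁆ * d)) * e [SMOD L.derived.toSubmodule] := by
    rw [SModEq.sub_mem, ← sub_mul]
    exact L.derived.right_mul_mem e (SModEq.sub_mem.1 (L.lie_mul_smodEq a hc hd))
  have key : 2 • (2 • ((⁅a, c⁆ * d) * e)) ≡ 2 • ((⁅a, c⁆ * d) * e)
      [SMOD L.derived.toSubmodule] := by
    calc 2 • (2 • ((⁅a, c⁆ * d) * e))
      _ ≡ 2 • (⁅a, c * d⁆ * e) [SMOD L.derived.toSubmodule] := by
        rw [← smul_mul_assoc]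
        exact h_mul_right.symm.nsmul 2
      _ ≡ ⁅a, (c * d) * e⁆ [SMOD L.derived.toSubmodule] :=
        (L.lie_mul_smodEq a (L.right_mul_mem d hc) he).symm
      _ ≡ ⁅a, c * (d * e)⁆ [SMOD L.derived.toSubmodule] := h_lie_assoc
      _ ≡ 2 • (⁅a, c⁆ * (d * e)) [SMOD L.derived.toSubmodule] :=
        L.lie_mul_smodEq a hc (L.right_mul_mem e hd)
      _ ≡ 2 • ((⁅a, c⁆ * d) * e) [SMOD L.derived.toSubmodule] :=
        (h_assoc (L.lie_mem a hc)).symm.nsmul 2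
  rw [SModEq.sub_mem, two_nsmul (2 • _), add_sub_cancel_right] at key
  exact mem_of_two_nsmul_mem key

variable (F A) in
/-- The Lie-solvable powers of a Novikov algebra, as ideals. -/
def derivedSeries : ℕ → AlgIdeal F A
  | 0 => ⊤
  | n + 1 => (derivedSeries n).derived

theorem toSubmodule_derivedSeries (n : ℕ) :
    (derivedSeries F A n).toSubmodule = lieSolvablePower F A n := by
  induction n with
  | zero => rfl
  | succ n ih =>
    change commutatorSpan _ _ = commutatorSpan _ _
    rw [ih]

theorem derivedSeries_succ_le (n : ℕ) :
    (derivedSeries F A (n + 1)).toSubmodule ≤ commutatorSpan ⊤ ⊤ :=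
  commutatorSpan_mono le_top le_top

end AlgIdeal

section RegularRightIdeal

variable {F A : Type*} [Ring F] [NonUnitalNonAssocRing A] [Module F A] [IsScalarTower F A A]

variable (F) in
/-- The image `A (1 - x)` of `a ↦ a - a x`. In a Novikov algebra it is the right ideal that controls
left-quasiregularity: `x` is left-quasiregular modulo an ideal `L` exactly if
`x ∈ A (1 - x) + L`. -/
def regularRightIdeal (x : A) : Submodule F A :=
  LinearMap.range (LinearMap.id - LinearMap.mulRight F x)

theorem sub_mul_mem_regularRightIdeal (a x : A) : a - a * x ∈ regularRightIdeal F x :=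
  ⟨a, rfl⟩

theorem mem_regularRightIdeal_sup_iff {x : A} {L : Submodule F A} :
    x ∈ regularRightIdeal F x ⊔ L ↔ ∃ y, x + y - y * x ∈ L := by
  constructor
  · intro h
    obtain ⟨_, ⟨z, rfl⟩, l, hl, hx⟩ := Submodule.mem_sup.1 h
    refine ⟨-z, ?_⟩
    convert hl using 1
    nth_rw 1 [← hx]
    simp only [LinearMap.sub_apply, LinearMap.id_apply, LinearMap.mulRight_apply, neg_mul]
    abel
  · rintro ⟨y, hy⟩
    have h := sub_mem (Submodule.mem_sup_right (S := regularRightIdeal F x) hy)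
      (Submodule.mem_sup_left (T := L) (sub_mul_mem_regularRightIdeal (F := F) y x))
    convert h using 1
    abel

theorem isLeftQuasiregularElt_iff_mem_regularRightIdeal {x : A} :
    IsLeftQuasiregularElt x ↔ x ∈ regularRightIdeal F x := by
  have h := mem_regularRightIdeal_sup_iff (x := x) (L := (⊥ : Submodule F A))
  simp only [sup_bot_eq, Submodule.mem_bot, sub_eq_zero] at h
  exact h.symm

theorem mul_mem_regularRightIdeal {F A : Type*} [Ring F] [NovikovRing A] [Module F A]
    [IsScalarTower F A A] {x : A} (a : A) {z : A} (hz : z ∈ regularRightIdeal F x) :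
    z * a ∈ regularRightIdeal F x := by
  obtain ⟨b, rfl⟩ := hz
  refine ⟨b * a, ?_⟩
  simp [sub_mul, NovikovRing.right_comm b a x]

end RegularRightIdeal

section Lifting

variable {F A : Type*} [Field F] [NovikovRing A] [Module F A] [IsScalarTower F A A] {x : A}

/-- An element `y` with `w = x + y - y x ∈ L` expresses every `l ∈ L` modulo `A (1 - x)` through
products with right factor in `L`: `l = l w + y (l x) - (y x) l`. -/
theorem regularRightIdeal_sup_eq_top_of_mul_mem {L : AlgIdeal F A} {U V : Submodule F A}
    (hL : regularRightIdeal F x ⊔ L.toSubmodule = ⊤) (hU : regularRightIdeal F x ⊔ U = ⊤)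
    (hV : ∀ u ∈ U, ∀ l ∈ L.toSubmodule, u * l ∈ V) : regularRightIdeal F x ⊔ V = ⊤ := by
  have mul_mem (a : A) {l : A} (hl : l ∈ L.toSubmodule) : a * l ∈ regularRightIdeal F x ⊔ V := by
    obtain ⟨m, hm, u, hu, rfl⟩ := Submodule.mem_sup.1 (hU ▸ Submodule.mem_top : a ∈ _ ⊔ U)
    rw [add_mul]
    exact Submodule.add_mem_sup (mul_mem_regularRightIdeal l hm) (hV u hu l hl)
  obtain ⟨y, hy⟩ := mem_regularRightIdeal_sup_iff.1
    (hL ▸ Submodule.mem_top : x ∈ regularRightIdeal F x ⊔ L.toSubmodule)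
  refine top_le_iff.1 (hL.ge.trans (sup_le le_sup_left fun l hl => ?_))
  have h_reg : (l - l * y) - (l - l * y) * x ∈ regularRightIdeal F x ⊔ V :=
    Submodule.mem_sup_left (sub_mul_mem_regularRightIdeal _ x)
  have h_decomp : l = ((l - l * y) - (l - l * y) * x) +
      (l * (x + y - y * x) + y * (l * x) - (y * x) * l) :=
    calc l = l + (associator l y x - associator y l x) := by
          rw [LeftPreLieRing.assoc_symm, sub_self, add_zero]
      _ = _ := by
          simp only [associator_apply, NovikovRing.right_comm y x l, sub_mul, mul_sub, mul_add]
          abel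
  rw [h_decomp]
  exact add_mem h_reg (sub_mem (add_mem (mul_mem l hy) (mul_mem y (L.right_mul_mem x hl)))
    (mul_mem (y * x) hl))

variable [NeZero (2 : F)] [SMulCommClass F A A]

theorem regularRightIdeal_sup_commutatorSpan_eq_top
    (hx : x ∈ regularRightIdeal F x ⊔ commutatorSpan ⊤ ⊤) :
    regularRightIdeal F x ⊔ commutatorSpan ⊤ ⊤ = ⊤ := by
  obtain ⟨y, hy⟩ := mem_regularRightIdeal_sup_iff.1 hx
  refine eq_top_iff.2 fun a _ => ?_
  have h_assoc : associator a y x ∈ commutatorSpan ⊤ ⊤ :=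
    (⊤ : AlgIdeal F A).associator_mem_derived x Submodule.mem_top Submodule.mem_top
  have h_mul : a * (x + y - y * x) ∈ commutatorSpan ⊤ ⊤ :=
    (⊤ : AlgIdeal F A).derived.left_mul_mem a hy
  have h_decomp : a = ((a - a * y) - (a - a * y) * x) +
      (a * (x + y - y * x) - associator a y x) := by
    simp only [associator_apply, mul_sub, mul_add, sub_mul]
    abel
  rw [h_decomp]
  exact Submodule.add_mem_sup (sub_mul_mem_regularRightIdeal _ x) (sub_mem h_mul h_assoc)

theorem regularRightIdeal_sup_derived_eq_top {L : AlgIdeal F A}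
    (hLC : L.toSubmodule ≤ commutatorSpan ⊤ ⊤)
    (hL : regularRightIdeal F x ⊔ L.toSubmodule = ⊤) :
    regularRightIdeal F x ⊔ L.derived.toSubmodule = ⊤ := by
  have h₁ : regularRightIdeal F x ⊔ commutatorSpan ⊤ L.toSubmodule = ⊤ :=
    regularRightIdeal_sup_eq_top_of_mul_mem hL hL fun l hl _ hl' =>
      L.mul_mem_commutatorSpan_top (hLC hl) hl'
  have h₂ : regularRightIdeal F x ⊔ Submodule.map₂ (LinearMap.mul F A)
      (commutatorSpan ⊤ L.toSubmodule) L.toSubmodule = ⊤ :=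
    regularRightIdeal_sup_eq_top_of_mul_mem hL h₁ fun _ hu _ hl =>
      Submodule.apply_mem_map₂ (LinearMap.mul F A) hu hl
  refine regularRightIdeal_sup_eq_top_of_mul_mem hL h₂ fun w hw e he => ?_
  suffices h : Submodule.map₂ (LinearMap.mul F A) (commutatorSpan ⊤ L.toSubmodule) L.toSubmodule ≤
      L.derived.toSubmodule.comap (LinearMap.mulRight F e) from h hw
  refine Submodule.map₂_le.2 fun u hu d hd => ?_
  exact map_mem_of_mem_commutatorSpan (LinearMap.mulRight F e ∘ₗ LinearMap.mulRight F d)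
    (fun a _ c hc => L.lie_mul_mul_mem_derived a hc hd he) hu

theorem regularRightIdeal_sup_derivedSeries_eq_top
    (hx : x ∈ regularRightIdeal F x ⊔ commutatorSpan ⊤ ⊤) (n : ℕ) :
    regularRightIdeal F x ⊔ (AlgIdeal.derivedSeries F A (n + 1)).toSubmodule = ⊤ := by
  induction n with
  | zero => exact regularRightIdeal_sup_commutatorSpan_eq_top hx
  | succ n ih =>
    exact regularRightIdeal_sup_derived_eq_top (AlgIdeal.derivedSeries_succ_le n) ih

theorem IsLieSolvableAlgebra.isLeftQuasiregularElt (hA : IsLieSolvableAlgebra F A)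
    (hx : x ∈ regularRightIdeal F x ⊔ commutatorSpan ⊤ ⊤) : IsLeftQuasiregularElt x := by
  obtain ⟨n, hn⟩ := hA
  have h_bot : (AlgIdeal.derivedSeries F A (n + 1)).toSubmodule = ⊥ := by
    rw [AlgIdeal.toSubmodule_derivedSeries]
    change commutatorSpan _ _ = ⊥
    rw [hn, commutatorSpan_bot_left]
  have h_top := regularRightIdeal_sup_derivedSeries_eq_top hx n
  rw [h_bot, sup_bot_eq] at h_top
  exact isLeftQuasiregularElt_iff_mem_regularRightIdeal.2 (h_top ▸ Submodule.mem_top)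

end Lifting

section FieldQuotient

universe u v

theorem exists_surjective_nonUnitalAlgHom_field_apply_eq_one {F : Type u} {B : Type v} [CommRing F]
    [NonUnitalCommRing B] [Module F B] [IsScalarTower F B B] [SMulCommClass F B B] {b : B}
    (hb : ¬ IsLeftQuasiregularElt b) :
    ∃ (K : Type (max u v)) (_ : Field K) (_ : Algebra F K) (φ : B →ₙₐ[F] K),
      Function.Surjective φ ∧ φ b = 1 := by
  have h_nonunit : ¬ IsUnit (1 + ((-b : B) : Unitization F B)) := by
    rw [← isQuasiregular_iff_isUnit' F, isQuasiregular_iff]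
    rintro ⟨y, -, hy⟩
    refine hb ⟨-y, ?_⟩
    rw [neg_mul, ← sub_eq_zero, ← neg_eq_zero, ← hy, mul_neg]
    abel
  obtain ⟨m, hm, hbm⟩ := exists_max_ideal_of_mem_nonunits h_nonunit
  let φ : B →ₙₐ[F] Unitization F B ⧸ m :=
    (Ideal.Quotient.mkₐ F m : Unitization F B →ₙₐ[F] _).comp (Unitization.inrNonUnitalAlgHom F B)
  have hφb : φ b = 1 := by
    refine (Ideal.Quotient.eq.2 ?_).symm
    simpa [sub_eq_add_neg] using hbm
  refine ⟨Unitization F B ⧸ m, Ideal.Quotient.field m, inferInstance, φ, fun k => ?_, hφb⟩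
  obtain ⟨w, rfl⟩ := Ideal.Quotient.mk_surjective k
  refine ⟨w.fst • b + w.snd * b, ?_⟩
  calc φ (w.fst • b + w.snd * b) = Ideal.Quotient.mk m (w * (b : Unitization F B)) := by
        refine congrArg (Ideal.Quotient.mk m) (Unitization.ext ?_ ?_) <;> simp
    _ = Ideal.Quotient.mk m w * φ b := map_mul _ _ _
    _ = Ideal.Quotient.mk m w := by rw [hφb, mul_one]

namespace AlgIdeal

section NonAssoc

variable {F A : Type*} [Field F] [NonUnitalNonAssocRing A] [Module F A]

/-- The projection `A → A / I` onto the quotient algebra. -/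
def toQuotHom (I : AlgIdeal F A) : A →ₙₐ[F] I.Quot where
  toFun := I.toQuot
  map_smul' _ _ := rfl
  map_zero' := rfl
  map_add' _ _ := rfl
  map_mul' _ _ := rfl

theorem toQuot_eq_toQuot_iff {I : AlgIdeal F A} {a b : A} :
    I.toQuot a = I.toQuot b ↔ a - b ∈ I.toSubmodule :=
  Submodule.Quotient.eq I.toSubmodule

theorem toQuot_eq_zero_iff {I : AlgIdeal F A} {a : A} : I.toQuot a = 0 ↔ a ∈ I.toSubmodule :=
  Submodule.Quotient.mk_eq_zero I.toSubmodule

theorem isLeftQuasiregularElt_toQuot_iff [IsScalarTower F A A] {L : AlgIdeal F A} {x : A} :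
    IsLeftQuasiregularElt (L.toQuot x) ↔ x ∈ regularRightIdeal F x ⊔ L.toSubmodule := by
  simp only [mem_regularRightIdeal_sup_iff, ← toQuot_eq_toQuot_iff, toQuot_add,
    toQuot_mul]
  exact L.toQuot_surjective.exists

instance (I : AlgIdeal F A) [IsScalarTower F A A] : IsScalarTower F I.Quot I.Quot where
  smul_assoc c u v := by
    obtain ⟨a, rfl⟩ := I.toQuot_surjective u
    obtain ⟨b, rfl⟩ := I.toQuot_surjective v
    exact congrArg I.toQuot (smul_mul_assoc c a b)

instance (I : AlgIdeal F A) [SMulCommClass F A A] : SMulCommClass F I.Quot I.Quot where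
  smul_comm c u v := by
    obtain ⟨a, rfl⟩ := I.toQuot_surjective u
    obtain ⟨b, rfl⟩ := I.toQuot_surjective v
    exact congrArg I.toQuot (smul_comm c a b)

section Ker

variable {K : Type*} [NonUnitalNonAssocRing K] [Module F K]

/-- The kernel of an algebra homomorphism. -/
def ker (φ : A →ₙₐ[F] K) : AlgIdeal F A where
  toSubmodule := LinearMap.ker (φ : A →ₗ[F] K)
  left_mul_mem a x hx := by
    have hx : φ x = 0 := hx
    change φ (a * x) = 0
    rw [map_mul, hx, mul_zero]
  right_mul_mem a x hx := by
    have hx : φ x = 0 := hx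
    change φ (x * a) = 0
    rw [map_mul, hx, zero_mul]

theorem mem_ker {φ : A →ₙₐ[F] K} {a : A} : a ∈ (ker φ).toSubmodule ↔ φ a = 0 :=
  Iff.rfl

theorem toQuot_ker_eq_iff {φ : A →ₙₐ[F] K} {a b : A} :
    (ker φ).toQuot a = (ker φ).toQuot b ↔ φ a = φ b := by
  rw [toQuot_eq_toQuot_iff, mem_ker, map_sub, sub_eq_zero]

end Ker

theorem isFieldAlgebra_quot_ker {K : Type*} [Field K] [Module F K] {φ : A →ₙₐ[F] K}
    (hφ : Function.Surjective φ) : IsFieldAlgebra (ker φ).Quot := by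
  have hsurj := (ker φ).toQuot_surjective
  obtain ⟨e, he⟩ := hφ 1
  refine ⟨hsurj.forall₂.2 fun a b => ?_, hsurj.forall₃.2 fun a b c => ?_, (ker φ).toQuot e, ?_,
    hsurj.forall.2 fun a => ?_, hsurj.forall.2 fun a ha => ?_⟩
  · rw [← toQuot_mul, ← toQuot_mul, toQuot_ker_eq_iff, map_mul, map_mul, mul_comm]
  · simp only [← toQuot_mul, toQuot_ker_eq_iff, map_mul, mul_assoc]
  · rw [Ne, toQuot_eq_zero_iff, mem_ker, he]
    exact one_ne_zero
  · rw [← toQuot_mul, toQuot_ker_eq_iff, map_mul, he, one_mul]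
  · rw [Ne, toQuot_eq_zero_iff, mem_ker] at ha
    obtain ⟨b, hb⟩ := hφ (φ a)⁻¹
    refine ⟨(ker φ).toQuot b, ?_⟩
    rw [← toQuot_mul, toQuot_ker_eq_iff, map_mul, hb, he, mul_inv_cancel₀ ha]

/-- A left-quasiregular ideal `J` not inside `I` would contain some `x ≡ 1` modulo `I`, but
`1 + y = y * 1` is impossible in `A / I`. -/
theorem le_of_isLeftQuasiregularAlgebra {I J : AlgIdeal F A}
    (hJ : IsLeftQuasiregularAlgebra J.toSubalgebra) (hI : IsFieldAlgebra I.Quot) :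
    J.toSubmodule ≤ I.toSubmodule := by
  intro a ha
  by_contra haI
  obtain ⟨hcomm, -, e, he, hone, hinv⟩ := hI
  obtain ⟨v, hv⟩ := hinv (I.toQuot a) (toQuot_eq_zero_iff.not.2 haI)
  obtain ⟨b, rfl⟩ := I.toQuot_surjective v
  obtain ⟨y, hy⟩ := hJ ⟨a * b, J.right_mul_mem b ha⟩
  have h : e + I.toQuot y = I.toQuot y := by
    have hyA : a * b + (y : A) = y * (a * b) := congrArg Subtype.val hy
    have hyQ := congrArg I.toQuot hyA
    rwa [toQuot_add, toQuot_mul _ _ (a * b), toQuot_mul _ a b, hv, hcomm _ e, hone] at hyQ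
  exact he (add_eq_right.1 h)

theorem isLeftQuasiregularAlgebra_toSubalgebra {J : AlgIdeal F A}
    (hJ : ∀ x ∈ J.toSubmodule, IsLeftQuasiregularElt x) :
    IsLeftQuasiregularAlgebra J.toSubalgebra := by
  rintro ⟨x, hx⟩
  obtain ⟨y, hy⟩ := hJ x hx
  have hyJ : y ∈ J.toSubmodule := by
    rw [eq_sub_of_add_eq' hy]
    exact sub_mem (J.left_mul_mem y hx) hx
  exact ⟨⟨y, hyJ⟩, Subtype.ext hy⟩

theorem le_leftQuasiregularRadical {J : AlgIdeal F A}
    (hJ : IsLeftQuasiregularAlgebra J.toSubalgebra) :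
    J.toSubmodule ≤ (leftQuasiregularRadical F A).toSubmodule :=
  le_sSup ⟨J, hJ, rfl⟩

variable (F A) in
/-- The intersection of the ideals `I` of `A` for which `A / I` is a field. -/
def fieldRadical : AlgIdeal F A where
  toSubmodule := sInf {S : Submodule F A | ∃ I : AlgIdeal F A,
    IsFieldAlgebra I.Quot ∧ S = I.toSubmodule}
  left_mul_mem a x hx := by
    rw [Submodule.mem_sInf] at hx ⊢
    rintro _ ⟨I, hI, rfl⟩
    exact I.left_mul_mem a (hx _ ⟨I, hI, rfl⟩)
  right_mul_mem a x hx := by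
    rw [Submodule.mem_sInf] at hx ⊢
    rintro _ ⟨I, hI, rfl⟩
    exact I.right_mul_mem a (hx _ ⟨I, hI, rfl⟩)

theorem fieldRadical_le {I : AlgIdeal F A} (hI : IsFieldAlgebra I.Quot) :
    (fieldRadical F A).toSubmodule ≤ I.toSubmodule :=
  sInf_le ⟨I, hI, rfl⟩

variable (F A) in
theorem leftQuasiregularRadical_le_fieldRadical :
    (leftQuasiregularRadical F A).toSubmodule ≤ (fieldRadical F A).toSubmodule := by
  refine sSup_le ?_
  rintro _ ⟨J, hJ, rfl⟩
  refine le_sInf ?_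
  rintro _ ⟨I, hI, rfl⟩
  exact le_of_isLeftQuasiregularAlgebra hJ hI

end NonAssoc

variable {F A : Type*} [Field F] [NeZero (2 : F)] [NovikovRing A] [Module F A]
  [IsScalarTower F A A] [SMulCommClass F A A]

instance : NonUnitalCommRing (⊤ : AlgIdeal F A).derived.Quot where
  mul_assoc := (toQuot_surjective _).forall₃.2 fun a b c => toQuot_eq_toQuot_iff.2 <|
    associator_mem_derived ⊤ c (Submodule.mem_top (x := a)) (Submodule.mem_top (x := b))
  mul_comm := (toQuot_surjective _).forall₂.2 fun a b => toQuot_eq_toQuot_iff.2 <|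
    lie_mem_commutatorSpan (Submodule.mem_top (x := a)) (Submodule.mem_top (x := b))

theorem mem_regularRightIdeal_sup_commutatorSpan_of_mem_fieldRadical {x : A}
    (hx : x ∈ (fieldRadical F A).toSubmodule) :
    x ∈ regularRightIdeal F x ⊔ commutatorSpan ⊤ ⊤ := by
  refine (isLeftQuasiregularElt_toQuot_iff (L := (⊤ : AlgIdeal F A).derived)).1 ?_
  by_contra hreg
  obtain ⟨K, _, _, φ, hφ, hφx⟩ :=
    exists_surjective_nonUnitalAlgHom_field_apply_eq_one (F := F) hreg
  let ψ : A →ₙₐ[F] K := φ.comp (toQuotHom _)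
  have hψ : Function.Surjective ψ := hφ.comp (toQuot_surjective _)
  have hψx : ψ x = 0 := fieldRadical_le (isFieldAlgebra_quot_ker hψ) hx
  exact one_ne_zero (hφx.symm.trans hψx)

end AlgIdeal

end FieldQuotient

theorem corollary3 (F A : Type*) [Field F] (hF : ringChar F ≠ 2)
    [NovikovRing A] [Module F A] [IsScalarTower F A A] [SMulCommClass F A A]
    (hA : IsLieSolvableAlgebra F A) :
    IsLeftQuasiregularAlgebra (leftQuasiregularRadical F A).toSubalgebra ∧
      (leftQuasiregularRadical F A).toSubmodule =
        sInf {S : Submodule F A | ∃ I : AlgIdeal F A,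
          IsFieldAlgebra I.Quot ∧ S = I.toSubmodule} := by
  have : NeZero (2 : F) := ⟨Ring.two_ne_zero hF⟩
  have h_le := AlgIdeal.leftQuasiregularRadical_le_fieldRadical F A
  have h_reg : ∀ x ∈ (AlgIdeal.fieldRadical F A).toSubmodule, IsLeftQuasiregularElt x :=
    fun _ hx => hA.isLeftQuasiregularElt <|
      AlgIdeal.mem_regularRightIdeal_sup_commutatorSpan_of_mem_fieldRadical hx
  exact ⟨AlgIdeal.isLeftQuasiregularAlgebra_toSubalgebra fun x hx => h_reg x (h_le hx),
    h_le.antisymm <| AlgIdeal.le_leftQuasiregularRadical <|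
      AlgIdeal.isLeftQuasiregularAlgebra_toSubalgebra h_reg⟩
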